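/- Let $d\ge 2$ and let $q_1,\dots,q_d\ge 2$ be integers. For each $j$ let $T_j$ be the homogeneous tree in which every vertex has degree $q_j+1$, with a chosen origin $o_j$, and with its edges oriented in such a way that every vertex $x$ has exactly one predecessor $x^-$ among its neighbours, all other neighbours $y$ of $x$ being successors, i.e. $y^-=x$ (such an orientation amounts to the choice of an end of $T_j$, with $x^-$ the neighbour of $x$ in the direction of this end). The ancestors of $x$ are $x, x^-, (x^-)^-,\dots$; any two vertices $x,y$ have a maximal common ancestor $x\curlywedge y$, that is, a common ancestor of which every common ancestor of $x$ and $y$ is an ancestor. The Busemann function of $T_j$ is $$\mathfrak h(x)=d(x,o_j\curlywedge x)-d(o_j,o_j\curlywedge x)\in\mathbb Z ,$$ where $d(\cdot,\cdot)$ is the graph distance. The graph $\mathsf{DL}(q_1,\dots,q_d)$ has vertex set $$\{(x_1,\dots,x_d)\in T_1\times\dots\times T_d:\ \mathfrak h(x_1)+\dots+\mathfrak h(x_d)=0\},$$ and $(x_1,\dots,x_d)$ and $(y_1,\dots,y_d)$ are neighbours if and only if there are $i\ne j$ such that $x_i\sim y_i$ in $T_i$, $x_j\sim y_j$ in $T_j$,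 and $x_k=y_k$ for all $k\ne i,j$. A locally finite graph $X$ is called amenable if its isoperimetric constant $$\kappa(X)=\inf\left\{\frac{|\partial F|}{\mathrm{Vol}(F)}:\ F\subset X\ \text{finite and non-empty}\right\}$$ is $0$, where $\partial F$ is the set of edges between $F$ and $X\setminus F$, and $\mathrm{Vol}(F)=\sum_{x\in F}\deg(x)$. Then $\mathsf{DL}(q_1,\dots,q_d)$ is amenable if and only if $q_1=\dots=q_d$. -/

import Mathlib

universe u

/-- An orientation of the edges of a graph `T` such that every vertex `x` has a unique predecessor
`pred x`, and such that every other neighbour `y` of `x` is a successor of `x`, i.e. `pred y = x`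
(each edge is oriented in exactly one direction). On a tree without leaves these orientations
correspond to the ends `ω`: `pred x` is the neighbour of `x` on the geodesic ray from `x`
to `ω`. -/
structure HoroOrientation {V : Type u} (T : SimpleGraph V) where
  /-- The predecessor `x⁻` of a vertex `x`. -/
  pred : V → V
  adj_pred : ∀ x, T.Adj x (pred x)
  xor_of_adj : ∀ x y, T.Adj x y → Xor (pred x = y) (pred y = x)

namespace HoroOrientation

variable {V : Type u} {T : SimpleGraph V}

/-- The ancestor relation: `a` lies on the ray `x, x⁻, (x⁻)⁻, …`. -/
def IsAncestor (ω : HoroOrientation T) (a x : V) : Prop :=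
  ∃ n : ℕ, ω.pred^[n] x = a

/-- `c` is a maximal common ancestor of `x` and `y`. -/
def IsConfluent (ω : HoroOrientation T) (x y c : V) : Prop :=
  ω.IsAncestor c x ∧ ω.IsAncestor c y ∧
    ∀ a, ω.IsAncestor a x → ω.IsAncestor a y → ω.IsAncestor a c

theorem exists_iterate_eq (ω : HoroOrientation T) (hT : T.Connected) (x y : V) :
    ∃ m n : ℕ, ω.pred^[m] x = ω.pred^[n] y := by
  obtain ⟨p⟩ := hT.preconnected x y
  induction p with
  | nil => exact ⟨0, 0, rfl⟩
  | @cons a b c h p ih =>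
    obtain ⟨m, n, hmn⟩ := ih
    rcases ω.xor_of_adj _ _ h with ⟨h1, _⟩ | ⟨h1, _⟩
    · exact ⟨m + 1, n, by rw [Function.iterate_succ_apply, h1, hmn]⟩
    · refine ⟨m, n + 1, ?_⟩
      rw [Function.iterate_succ_apply', ← hmn, ← Function.iterate_succ_apply' ω.pred m b,
        Function.iterate_succ_apply, h1]

theorem exists_isConfluent (ω : HoroOrientation T) (hT : T.Connected) (x y : V) :
    ∃ c, ω.IsConfluent x y c := by
  classical
  have hex : ∃ m : ℕ, ω.IsAncestor (ω.pred^[m] x) y := by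
    obtain ⟨m, n, h⟩ := ω.exists_iterate_eq hT x y
    exact ⟨m, n, h.symm⟩
  refine ⟨ω.pred^[Nat.find hex] x, ⟨_, rfl⟩, Nat.find_spec hex, ?_⟩
  rintro a ⟨k, rfl⟩ hy
  have hk : Nat.find hex ≤ k := Nat.find_min' hex hy
  refine ⟨k - Nat.find hex, ?_⟩
  rw [← Function.iterate_add_apply, Nat.sub_add_cancel hk]

/-- The maximal common ancestor `x ⋏ y`. -/
noncomputable def confluent (ω : HoroOrientation T) (hT : T.Connected) (x y : V) : V :=
  (ω.exists_isConfluent hT x y).choose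

/-- The Busemann function with origin `o`:
`x ↦ d(x, o ⋏ x) - d(o, o ⋏ x)`. -/
noncomputable def busemann (ω : HoroOrientation T) (hT : T.Connected) (o x : V) : ℤ :=
  (T.dist x (ω.confluent hT o x) : ℤ) - (T.dist o (ω.confluent hT o x) : ℤ)

end HoroOrientation

/-- The vertices of the horocyclic product of sets `X j` with integer-valued functions `h j`. -/
def HorocyclicVertex {d : ℕ} {X : Fin d → Type u} (h : ∀ j, X j → ℤ) : Type u :=
  {x : ∀ j, X j // ∑ j, h j (x j) = 0}

/-- The horocyclic product of graphs `G j` with respect to the functions `h j`: two vertices are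
neighbours if they are neighbours in exactly two coordinates and agree in all the others. -/
def horocyclicProduct {d : ℕ} {X : Fin d → Type u} (G : ∀ j, SimpleGraph (X j))
    (h : ∀ j, X j → ℤ) : SimpleGraph (HorocyclicVertex h) where
  Adj x y := ∃ i j : Fin d, i ≠ j ∧ (G i).Adj (x.1 i) (y.1 i) ∧ (G j).Adj (x.1 j) (y.1 j) ∧
    ∀ k, k ≠ i → k ≠ j → x.1 k = y.1 k
  symm := ⟨by
    rintro x y ⟨i, j, hij, hi, hj, hk⟩
    exact ⟨i, j, hij, hi.symm, hj.symm, fun k h1 h2 => (hk k h1 h2).symm⟩⟩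
  loopless := ⟨by
    rintro x ⟨i, j, _, hi, _⟩
    exact (G i).loopless.irrefl _ hi⟩

theorem horocyclicProduct_finite_neighborSet {d : ℕ} {X : Fin d → Type u}
    (G : ∀ j, SimpleGraph (X j)) [∀ j, (G j).LocallyFinite] (h : ∀ j, X j → ℤ)
    (x : HorocyclicVertex h) : ((horocyclicProduct G h).neighborSet x).Finite := by
  have hfin : (Set.univ.pi fun j => insert (x.1 j) ((G j).neighborSet (x.1 j))).Finite :=
    Set.Finite.pi fun j => (Set.toFinite ((G j).neighborSet (x.1 j))).insert _
  refine (hfin.preimage (f := fun y : HorocyclicVertex h => y.1)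
    (Subtype.val_injective.injOn)).subset ?_
  rintro y ⟨i, j, _, hi, hj, hk⟩ k _
  by_cases h1 : k = i
  · subst h1; exact Or.inr hi
  by_cases h2 : k = j
  · subst h2; exact Or.inr hj
  exact Or.inl (hk k h1 h2).symm

noncomputable instance horocyclicProduct_locallyFinite {d : ℕ} {X : Fin d → Type u}
    (G : ∀ j, SimpleGraph (X j)) [∀ j, (G j).LocallyFinite] (h : ∀ j, X j → ℤ) :
    (horocyclicProduct G h).LocallyFinite :=
  fun x => (horocyclicProduct_finite_neighborSet G h x).fintype

/-- The Diestel–Leader graph: the horocyclic product of the trees `T j` with respect to their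
Busemann functions. -/
noncomputable abbrev DLGraph {d : ℕ} {V : Fin d → Type u} (T : ∀ j, SimpleGraph (V j))
    (hT : ∀ j, (T j).IsTree) (ω : ∀ j, HoroOrientation (T j)) (o : ∀ j, V j) :
    SimpleGraph (HorocyclicVertex fun j => (ω j).busemann (hT j).connected (o j)) :=
  horocyclicProduct T fun j => (ω j).busemann (hT j).connected (o j)

namespace SimpleGraph

/-- The edge boundary of `F`: the set of edges between `F` and its complement. -/
def edgeBoundarySet {V : Type u} (G : SimpleGraph V) (F : Finset V) : Set (Sym2 V) :=
  {e | ∃ x y, x ∈ F ∧ y ∉ F ∧ G.Adj x y ∧ e = s(x, y)}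

/-- `Vol(F)`, the sum of the degrees of the vertices in `F`. -/
def vol {V : Type u} (G : SimpleGraph V) [G.LocallyFinite] (F : Finset V) : ℕ :=
  ∑ x ∈ F, G.degree x

/-- The isoperimetric constant `inf |∂F| / Vol(F)` over all non-empty finite `F`. -/
noncomputable def isoperimetricConstant {V : Type u} (G : SimpleGraph V) [G.LocallyFinite] : ℝ :=
  sInf {r : ℝ | ∃ F : Finset V, F.Nonempty ∧ r = ((G.edgeBoundarySet F).ncard : ℝ) / (G.vol F : ℝ)}

/-- A locally finite graph is amenable if its isoperimetric constant is zero. -/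
def IsAmenable {V : Type u} (G : SimpleGraph V) [G.LocallyFinite] : Prop :=
  G.isoperimetricConstant = 0

end SimpleGraph

/-! Every edge of the graph moves to the predecessor in one coordinate `i` and to a successor in
another coordinate `j`, since Busemann heights change by one and must keep sum zero.

If `q i < q j`, these moves give each vertex `q j` outgoing and `q i` incoming edges. In a finite
`F` at most `F.card * q i` of the outgoing edges can end in `F`, so at least `F.card` of them leave
it. Degrees are bounded, hence the isoperimetric constant is positive
(`card_mul_le_ncard_edgeBoundarySet`, `ncard_shift`).

If all `q j` equal `q`, fix the ancestor `a j` of `o j` at distance `N`, and let `F` be the vertices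
each of whose coordinates descends from `a j`, by `k j` generations. The heights force `∑ k j = d *
N`, and each such composition contributes the same number `q ^ (d * N)` of vertices. A boundary edge
needs some `k j = 0`, and the proportion of such compositions is `O(1 / N)` for fixed `d`
(`exists_finset_iterate_mem`, `card_piAntidiag_filter_exists_mul_le`). -/

namespace HoroOrientation

/-! ### Predecessor rays and Busemann heights -/

variable {V : Type u} {T : SimpleGraph V} (ω : HoroOrientation T)

theorem pred_pred_ne (x : V) : ω.pred (ω.pred x) ≠ x := by
  intro h
  have := ω.xor_of_adj _ _ (ω.adj_pred x)
  simp [Xor, h] at this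

/-- The initial segment of length `n` of the ray `x, x⁻, (x⁻)⁻, …`. -/
def predWalk : (n : ℕ) → (x : V) → T.Walk x (ω.pred^[n] x)
  | 0, _ => .nil
  | n + 1, x => .cons (ω.adj_pred x) (predWalk n (ω.pred x))

theorem length_predWalk (n : ℕ) (x : V) : (ω.predWalk n x).length = n := by
  induction n generalizing x with
  | zero => rfl
  | succ n ih => simp [predWalk, ih]

/-- In an acyclic graph a walk without backtracking is a path, so this makes predecessor rays
geodesic. -/
theorem isChain_edges_predWalk (n : ℕ) (x : V) :
    (ω.predWalk n x).edges.IsChain (· ≠ ·) := by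
  induction n generalizing x with
  | zero => simp [predWalk]
  | succ n ih =>
    cases n with
    | zero => simp [predWalk]
    | succ n =>
      have := ih (ω.pred x)
      simp only [predWalk] at this ⊢
      refine List.IsChain.cons_cons ?_ this
      have h := ω.pred_pred_ne x
      have h' := (ω.adj_pred x).ne
      intro he
      rcases Sym2.eq_iff.1 he with ⟨h1, -⟩ | ⟨h1, -⟩
      · exact h' h1
      · exact h h1.symm

theorem dist_iterate_pred (hT : T.IsTree) (n : ℕ) (x : V) :
    T.dist x (ω.pred^[n] x) = n := by
  obtain ⟨p, hp, hl⟩ := hT.connected.exists_path_of_dist x (ω.pred^[n] x)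
  have hw := (hT.isAcyclic.isPath_iff_isChain _).2 (ω.isChain_edges_predWalk n x)
  rw [← hl, (hT.existsUnique_path _ _).unique hp hw, length_predWalk]

theorem iterate_pred_injective (hT : T.IsTree) (x : V) :
    Function.Injective fun n => ω.pred^[n] x := by
  intro m n h
  rw [← ω.dist_iterate_pred hT m x, ← ω.dist_iterate_pred hT n x]
  exact congrArg _ h

/-- Any common ancestor computes the height: it lies some `k` steps beyond the maximal one, and `k`
cancels in the difference. -/
theorem busemann_eq_of_iterate_eq (hT : T.IsTree) {o x : V} {m n : ℕ}
    (h : ω.pred^[m] x = ω.pred^[n] o) :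
    ω.busemann hT.connected o x = (m : ℤ) - n := by
  obtain ⟨⟨a, ha⟩, ⟨b, hb⟩, hmax⟩ := (ω.exists_isConfluent hT.connected o x).choose_spec
  obtain ⟨k, hk⟩ := hmax _ ⟨n, rfl⟩ ⟨m, h⟩
  change ω.pred^[a] o = ω.confluent hT.connected o x at ha
  change ω.pred^[b] x = ω.confluent hT.connected o x at hb
  change ω.pred^[k] (ω.confluent hT.connected o x) = _ at hk
  have h1 : n = k + a := by
    apply ω.iterate_pred_injective hT o
    simp only [Function.iterate_add_apply, ha, hk]
  have h2 : m = k + b := by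
    apply ω.iterate_pred_injective hT x
    simp only [Function.iterate_add_apply, hb, hk, h]
  have da := ω.dist_iterate_pred hT a o
  have db := ω.dist_iterate_pred hT b x
  rw [ha] at da
  rw [hb] at db
  rw [busemann, da, db, h1, h2]
  push_cast
  ring

theorem busemann_self (hT : T.IsTree) (o : V) : ω.busemann hT.connected o o = 0 := by
  simpa using ω.busemann_eq_of_iterate_eq hT (o := o) (x := o) (m := 0) (n := 0) rfl

theorem busemann_pred (hT : T.IsTree) (o x : V) :
    ω.busemann hT.connected o (ω.pred x) = ω.busemann hT.connected o x - 1 := by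
  obtain ⟨m, n, h⟩ := ω.exists_iterate_eq hT.connected x o
  have h1 : ω.pred^[m] (ω.pred x) = ω.pred^[n + 1] o := by
    rw [← Function.iterate_succ_apply, Function.iterate_succ_apply', h,
      Function.iterate_succ_apply']
  rw [ω.busemann_eq_of_iterate_eq hT h, ω.busemann_eq_of_iterate_eq hT h1]
  push_cast
  ring

theorem adj_iff (x y : V) : T.Adj x y ↔ ω.pred x = y ∨ ω.pred y = x := by
  constructor
  · intro h
    exact (ω.xor_of_adj _ _ h).imp And.left And.left
  · rintro (rfl | rfl)
    · exact ω.adj_pred _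
    · exact (ω.adj_pred _).symm

theorem ncard_successors [T.LocallyFinite] {q : ℕ} (hreg : T.IsRegularOfDegree (q + 1)) (x : V) :
    {y | ω.pred y = x}.ncard = q := by
  have h : {y | ω.pred y = x} = T.neighborSet x \ {ω.pred x} := by
    ext y
    simp only [Set.mem_ofPred_eq, Set.mem_sdiff, SimpleGraph.mem_neighborSet, ω.adj_iff,
      Set.mem_singleton_iff]
    constructor
    · rintro rfl
      exact ⟨Or.inr rfl, (ω.pred_pred_ne y).symm⟩
    · rintro ⟨rfl | h, h'⟩
      · exact absurd rfl h'
      · exact h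
  have hmem : ω.pred x ∈ T.neighborSet x := ω.adj_pred x
  rw [h, Set.ncard_sdiff_singleton_of_mem hmem, ← Nat.card_coe_set_eq,
    Nat.card_eq_fintype_card, SimpleGraph.card_neighborSet_eq_degree, hreg x]
  rfl

theorem finite_successors [T.LocallyFinite] (x : V) : {y | ω.pred y = x}.Finite :=
  (Set.toFinite (T.neighborSet x)).subset fun _ h => (ω.adj_iff _ _).2 (Or.inr h)

end HoroOrientation

/-- The points which a self-map `f` sends to `a` after `n` steps form `q ^ n` points if all fibres
of `f` have `q` points. -/
theorem exists_finset_iterate_eq {X : Type u} (f : X → X) (q : ℕ)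
    (hfin : ∀ x, {y | f y = x}.Finite) (hf : ∀ x, {y | f y = x}.ncard = q) (n : ℕ) (a : X) :
    ∃ s : Finset X, (∀ x, x ∈ s ↔ f^[n] x = a) ∧ s.card = q ^ n := by
  classical
  induction n with
  | zero => exact ⟨{a}, by simp, by simp⟩
  | succ n ih =>
    obtain ⟨s, hs, hc⟩ := ih
    refine ⟨s.biUnion fun x => (hfin x).toFinset, fun x => ?_, ?_⟩
    · simp [hs]
    · rw [Finset.card_biUnion, Finset.sum_const_nat (m := q), hc, pow_succ]
      · intro x _
        rw [← Set.ncard_eq_toFinset_card _ (hfin x), hf]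
      · intro x _ y _ hxy
        rw [Function.onFun, Finset.disjoint_left]
        intro z hz hz'
        simp only [Set.Finite.mem_toFinset, Set.mem_ofPred_eq] at hz hz'
        exact hxy (hz.symm.trans hz')

/-! ### Edge boundaries and the isoperimetric constant -/

namespace SimpleGraph

variable {V : Type u} (G : SimpleGraph V) [G.LocallyFinite]

theorem finite_edgeBoundarySet (F : Finset V) : (G.edgeBoundarySet F).Finite := by
  classical
  refine (F.biUnion fun x => (G.neighborFinset x).image fun y => s(x, y)).finite_toSet.subset ?_
  rintro _ ⟨x, y, hx, _, hxy, rfl⟩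
  simp only [Finset.coe_biUnion, Set.mem_iUnion]
  exact ⟨x, hx, by simpa using ⟨y, hxy, Or.inl rfl⟩⟩

theorem ncard_edgeBoundarySet_le {F B : Finset V} {D : ℕ}
    (hB : ∀ x ∈ F, x ∉ B → ∀ y, G.Adj x y → y ∈ F) (hD : ∀ x, G.degree x ≤ D) :
    (G.edgeBoundarySet F).ncard ≤ B.card * D := by
  classical
  calc (G.edgeBoundarySet F).ncard
      ≤ (B.biUnion fun x => (G.neighborFinset x).image fun y => s(x, y)).card := by
        rw [← Set.ncard_coe_finset]
        refine Set.ncard_le_ncard ?_ (Finset.finite_toSet _)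
        rintro _ ⟨x, y, hx, hy, hxy, rfl⟩
        have hxB : x ∈ B := by
          by_contra h
          exact hy (hB x hx h y hxy)
        simp only [Finset.coe_biUnion, Set.mem_iUnion]
        exact ⟨x, hxB, by simpa using ⟨y, hxy, Or.inl rfl⟩⟩
    _ ≤ B.card * D := by
        refine Finset.card_biUnion_le_card_mul _ _ _ fun x _ => ?_
        exact Finset.card_image_le.trans (hD x)

/-- A relation along edges with more successors than predecessors at every vertex produces a flow
out of every finite set. -/
theorem card_mul_le_ncard_edgeBoundarySet (R : V → V → Prop) (hR : ∀ x y, R x y → G.Adj x y)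
    {a b : ℕ} (hb : ∀ x, b ≤ {y | R x y}.ncard) (ha : ∀ y, {x | R x y}.ncard ≤ a)
    (F : Finset V) : F.card * b ≤ F.card * a + (G.edgeBoundarySet F).ncard := by
  classical
  have hfin : ∀ x, {y | R x y}.Finite := fun x =>
    (Set.toFinite (G.neighborSet x)).subset fun y h => hR x y h
  let out : V → Finset V := fun x => (hfin x).toFinset
  have hout : ∀ x y, y ∈ out x ↔ R x y := by simp [out]
  have h1 : F.card * b ≤ (F.sigma out).card := by
    rw [Finset.card_sigma, ← smul_eq_mul]
    refine Finset.card_nsmul_le_sum _ _ _ fun x _ => ?_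
    rw [← Set.ncard_eq_toFinset_card _ (hfin x)]
    exact hb x
  -- Pairs staying in `F` are grouped by their endpoint, which has at most `a` predecessors under
  -- `R`.
  have h2 : ((F.sigma out).filter fun p => p.2 ∈ F).card ≤ F.card * a := by
    rw [mul_comm]
    refine Finset.card_le_mul_card_image_of_maps_to (f := fun p : (_ : V) × V => p.2) (t := F)
      (fun p hp => (Finset.mem_filter.1 hp).2) _ fun y _ => ?_
    refine le_trans ?_ (ha y)
    have hfin' : {x | R x y}.Finite :=
      (Set.toFinite (G.neighborSet y)).subset fun x h => (hR x y h).symm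
    rw [← Set.ncard_coe_finset]
    refine Set.ncard_le_ncard_of_injOn (fun p => p.1) ?_ ?_ hfin'
    · rintro ⟨x, z⟩ hp
      simp only [Finset.coe_filter, Finset.mem_filter, Finset.mem_sigma, hout,
        Set.mem_ofPred_eq] at hp
      obtain ⟨⟨⟨_, h⟩, _⟩, rfl⟩ := hp
      exact h
    · rintro ⟨x, z⟩ hp ⟨x', z'⟩ hp' h
      simp only [Finset.coe_filter, Set.mem_ofPred_eq] at hp hp' h
      simp [h, hp.2, hp'.2]
  -- A boundary edge has only one endpoint in `F`, so the unordered edge determines the ordered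
  -- pair.
  have h3 : ((F.sigma out).filter fun p => p.2 ∉ F).card ≤ (G.edgeBoundarySet F).ncard := by
    rw [← Set.ncard_coe_finset]
    refine Set.ncard_le_ncard_of_injOn (fun p => s(p.1, p.2)) ?_ ?_ (G.finite_edgeBoundarySet F)
    · rintro ⟨x, y⟩ hp
      simp only [Finset.coe_filter, Finset.mem_sigma, hout, Set.mem_ofPred_eq] at hp
      exact ⟨x, y, hp.1.1, hp.2, hR _ _ hp.1.2, rfl⟩
    · rintro ⟨x, y⟩ hp ⟨x', y'⟩ hp' h
      simp only [Finset.coe_filter, Finset.mem_sigma, Set.mem_ofPred_eq, Sym2.eq_iff] at hp hp' h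
      rcases h with ⟨rfl, rfl⟩ | ⟨rfl, rfl⟩
      · rfl
      · exact absurd hp'.1.1 hp.2
  have h4 := Finset.card_filter_add_card_filter_not (s := F.sigma out) fun p => p.2 ∈ F
  omega

theorem vol_le {D : ℕ} (hD : ∀ x, G.degree x ≤ D) (F : Finset V) : G.vol F ≤ F.card * D :=
  Finset.sum_le_card_nsmul _ _ _ fun x _ => hD x

theorem card_le_vol (hpos : ∀ x, 0 < G.degree x) (F : Finset V) : F.card ≤ G.vol F :=
  (mul_one F.card).symm.trans_le (Finset.card_nsmul_le_sum F _ 1 fun x _ => hpos x)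

theorem not_isAmenable_of_card_le [Nonempty V] {D : ℕ} (hD : ∀ x, G.degree x ≤ D)
    (hpos : ∀ x, 0 < G.degree x)
    (h : ∀ F : Finset V, F.card ≤ (G.edgeBoundarySet F).ncard) : ¬ G.IsAmenable := by
  obtain ⟨x⟩ := ‹Nonempty V›
  have hD0 : 0 < D := (hpos x).trans_le (hD x)
  have : (1 : ℝ) / D ≤ G.isoperimetricConstant := by
    refine le_csInf ⟨_, {x}, Finset.singleton_nonempty x, rfl⟩ ?_
    rintro _ ⟨F, hF, rfl⟩
    have hv : 0 < G.vol F := hF.card_pos.trans_le (G.card_le_vol hpos F)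
    rw [div_le_div_iff₀ (by positivity) (by positivity), one_mul]
    exact_mod_cast (G.vol_le hD F).trans (Nat.mul_le_mul_right D (h F))
  have h0 : (0 : ℝ) < 1 / D := by positivity
  exact (h0.trans_le this).ne'

theorem isAmenable_of_forall_exists {C : ℕ} (hpos : ∀ x, 0 < G.degree x)
    (h : ∀ n : ℕ, ∃ F : Finset V, F.Nonempty ∧
      (G.edgeBoundarySet F).ncard * (n + 1) ≤ C * F.card) : G.IsAmenable := by
  have hbdd : BddBelow {r : ℝ | ∃ F : Finset V, F.Nonempty ∧
      r = ((G.edgeBoundarySet F).ncard : ℝ) / (G.vol F : ℝ)} :=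
    ⟨0, by rintro _ ⟨F, _, rfl⟩; positivity⟩
  refine le_antisymm ?_ (Real.sInf_nonneg (by rintro _ ⟨F, _, rfl⟩; positivity))
  refine ge_of_tendsto' (x := Filter.atTop) (f := fun n : ℕ => (C : ℝ) * (1 / ((n : ℝ) + 1))) ?_
    fun n => ?_
  · simpa using tendsto_one_div_add_atTop_nhds_zero_nat.const_mul (C : ℝ)
  obtain ⟨F, hF, hle⟩ := h n
  refine (csInf_le hbdd ⟨F, hF, rfl⟩).trans ?_
  have hv : 0 < G.vol F := hF.card_pos.trans_le (G.card_le_vol hpos F)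
  rw [mul_one_div, div_le_div_iff₀ (by positivity) (by positivity)]
  exact_mod_cast hle.trans (Nat.mul_le_mul_left C (G.card_le_vol hpos F))

end SimpleGraph

/-! ### Compositions with a vanishing part -/

open Finset in
-- Moving `t ≤ n` units from part `j` to the empty part `i` is injective in `(k, t)`: the new part
-- `i` is `t` itself.
theorem card_piAntidiag_filter_mul_le {d n : ℕ} (i j : Fin d) (hij : i ≠ j) :
    #{k ∈ piAntidiag (univ : Finset (Fin d)) (d * n) | k i = 0 ∧ n ≤ k j} * (n + 1) ≤
      #(piAntidiag (univ : Finset (Fin d)) (d * n)) := by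
  rw [← card_range (n + 1), ← card_product]
  refine card_le_card_of_injOn
    (fun p => Function.update (Function.update p.1 i p.2) j (p.1 j - p.2)) ?_ ?_
  · rintro ⟨k, t⟩ hp
    simp only [coe_product, coe_filter, mem_piAntidiag, Set.mem_prod, Set.mem_ofPred_eq, coe_range,
      Set.mem_Iio] at hp
    obtain ⟨⟨⟨hs, -⟩, hi, hj⟩, ht⟩ := hp
    simp only [mem_coe, mem_piAntidiag, mem_univ, implies_true, and_true]
    have key : Function.update (Function.update k i t) j (k j - t) + Pi.single j t
        = k + Pi.single i t := by
      ext l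
      by_cases h1 : l = j
      · subst h1
        simp [hij.symm]
        omega
      by_cases h2 : l = i
      · subst h2
        simp [hij, hi]
      · simp [h1, h2]
    have := congrArg (fun f : Fin d → ℕ => ∑ l, f l) key
    simp only [Pi.add_apply, sum_add_distrib, sum_pi_single', mem_univ, if_true] at this
    simpa [hs] using this
  · rintro ⟨k, t⟩ hp ⟨k', t'⟩ hp' h
    simp only [coe_product, coe_filter, Set.mem_prod, Set.mem_ofPred_eq, coe_range,
      Set.mem_Iio] at hp hp' h
    have h0 : t = t' := by simpa [hij] using congrFun h i
    subst h0
    congr 1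
    ext l
    by_cases h1 : l = j
    · subst h1
      have := congrFun h l
      simp at this
      omega
    by_cases h2 : l = i
    · subst h2
      omega
    · simpa [h1, h2] using congrFun h l

open Finset in
/-- The number of compositions of `d * n` into `d` parts one of which vanishes. -/
theorem card_piAntidiag_filter_exists_mul_le {d n : ℕ} (hn : 0 < n) :
    #{k ∈ piAntidiag (univ : Finset (Fin d)) (d * n) | ∃ i, k i = 0} * (n + 1) ≤
      d * d * #(piAntidiag (univ : Finset (Fin d)) (d * n)) := by
  -- The mean part is `n`, so some part is at least `n > 0` and differs from the vanishing one.
  have hsub : {k ∈ piAntidiag (univ : Finset (Fin d)) (d * n) | ∃ i, k i = 0} ⊆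
      ((univ : Finset (Fin d × Fin d)).filter fun p => p.1 ≠ p.2).biUnion fun p =>
        {k ∈ piAntidiag (univ : Finset (Fin d)) (d * n) | k p.1 = 0 ∧ n ≤ k p.2} := by
    intro k hk
    simp only [mem_filter, mem_piAntidiag, mem_univ, implies_true, and_true] at hk
    obtain ⟨hs, i, hi⟩ := hk
    obtain ⟨j, -, hj⟩ : ∃ j ∈ (univ : Finset (Fin d)), n ≤ k j := by
      refine exists_le_of_sum_le (f := fun _ => n) ⟨i, mem_univ i⟩ ?_
      simp [hs]
    simp only [mem_biUnion, mem_filter, mem_univ, true_and, mem_piAntidiag, implies_true, and_true]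
    refine ⟨(i, j), ?_, hs, hi, hj⟩
    rintro (rfl : i = j)
    omega
  calc _ ≤ (∑ p : Fin d × Fin d with p.1 ≠ p.2,
          #{k ∈ piAntidiag (univ : Finset (Fin d)) (d * n) | k p.1 = 0 ∧ n ≤ k p.2}) * (n + 1) :=
        Nat.mul_le_mul_right _ ((card_le_card hsub).trans card_biUnion_le)
    _ = ∑ p : Fin d × Fin d with p.1 ≠ p.2,
          #{k ∈ piAntidiag (univ : Finset (Fin d)) (d * n) | k p.1 = 0 ∧ n ≤ k p.2} * (n + 1) :=
        sum_mul _ _ _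
    _ ≤ ∑ p : Fin d × Fin d with p.1 ≠ p.2, #(piAntidiag (univ : Finset (Fin d)) (d * n)) :=
        sum_le_sum fun p hp => card_piAntidiag_filter_mul_le _ _ (mem_filter.1 hp).2
    _ ≤ d * d * #(piAntidiag (univ : Finset (Fin d)) (d * n)) := by
        rw [sum_const, smul_eq_mul]
        refine Nat.mul_le_mul_right _ ((card_le_univ _).trans ?_)
        simp

/-! ### Edges and finite sets in horocyclic products -/

section Horocyclic

variable {d : ℕ} {X : Fin d → Type u} {G : ∀ j, SimpleGraph (X j)} {h : ∀ j, X j → ℤ}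

theorem horocyclicProduct_degree_le [∀ j, (G j).LocallyFinite] {D : Fin d → ℕ}
    (hD : ∀ j x, (G j).degree x ≤ D j) (x : HorocyclicVertex h) :
    (horocyclicProduct G h).degree x ≤ ∏ j, (D j + 1) := by
  classical
  calc (horocyclicProduct G h).degree x
      ≤ (Fintype.piFinset fun j => insert (x.1 j) ((G j).neighborFinset (x.1 j))).card := by
        refine Finset.card_le_card_of_injOn (fun y => y.1) ?_ Subtype.val_injective.injOn
        intro y hy
        have hy' : (horocyclicProduct G h).Adj x y := by simpa using hy
        obtain ⟨i, j, _, hi, hj, hk⟩ := hy'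
        simp only [Finset.mem_coe, Fintype.mem_piFinset, Finset.mem_insert,
          SimpleGraph.mem_neighborFinset]
        intro k
        by_cases h1 : k = i
        · subst h1; exact Or.inr hi
        by_cases h2 : k = j
        · subst h2; exact Or.inr hj
        exact Or.inl (hk k h1 h2).symm
    _ ≤ ∏ j, (D j + 1) := by
        rw [Fintype.card_piFinset]
        refine Finset.prod_le_prod' fun j _ => (Finset.card_insert_le _ _).trans ?_
        exact Nat.add_le_add_right (hD j _) 1

/-- `y` arises from `x` by passing to the predecessor in the coordinate `i` and to a successor in
the coordinate `j`. -/
def HorocyclicVertex.Shift (p : ∀ j, X j → X j) (i j : Fin d) (x y : HorocyclicVertex h) : Prop :=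
  p i (x.1 i) = y.1 i ∧ p j (y.1 j) = x.1 j ∧ ∀ k, k ≠ i → k ≠ j → x.1 k = y.1 k

namespace HorocyclicVertex

variable {p : ∀ j, X j → X j}

theorem shift_comm {i j : Fin d} {x y : HorocyclicVertex h} :
    Shift p i j x y ↔ Shift p j i y x := by
  constructor <;>
  · rintro ⟨h1, h2, h3⟩
    exact ⟨h2, h1, fun k hk hk' => (h3 k hk' hk).symm⟩

/-- The target is determined by its coordinate `j`, and every successor is admissible there because
the height changes at `i` and `j` cancel. -/
theorem ncard_shift (hp : ∀ j x, h j (p j x) = h j x - 1) {i j : Fin d} (hij : i ≠ j)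
    (x : HorocyclicVertex h) : {y | Shift p i j x y}.ncard = {s | p j s = x.1 j}.ncard := by
  refine Set.ncard_congr (fun y _ => y.1 j) (fun y hy => hy.2.1) ?_ ?_
  · rintro y z ⟨h1, h2, h3⟩ ⟨h1', h2', h3'⟩ hyz
    refine Subtype.ext (funext fun k => ?_)
    by_cases hi : k = i
    · subst hi; exact h1.symm.trans h1'
    by_cases hj : k = j
    · subst hj; exact hyz
    · exact (h3 k hi hj).symm.trans (h3' k hi hj)
  · intro s hs
    have hs' : p j s = x.1 j := hs
    have hsum : ∑ k, h k (Function.update (Function.update x.1 i (p i (x.1 i))) j s k) = 0 := by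
      have hx := x.2
      have key : (fun k => h k (Function.update (Function.update x.1 i (p i (x.1 i))) j s k)) +
          Pi.single i 1 = (fun k => h k (x.1 k)) + Pi.single j 1 := by
        ext k
        by_cases hj : k = j
        · subst hj
          have := hp k s
          rw [hs'] at this
          simp [hij.symm, this]
        by_cases hi : k = i
        · subst hi
          simp [hj, hp]
        · simp [hi, hj]
      have := congrArg (fun f : Fin d → ℤ => ∑ l, f l) key
      simpa [Finset.sum_add_distrib, hx] using this
    refine ⟨⟨_, hsum⟩, ⟨?_, ?_, ?_⟩, ?_⟩
    · simp [hij]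
    · simpa using hs'
    · intro k hi hj
      simp [hi, hj]
    · simp

variable (hG : ∀ j x y, (G j).Adj x y ↔ p j x = y ∨ p j y = x)
  (hp : ∀ j x, h j (p j x) = h j x - 1)

include hG in
theorem Shift.adj {i j : Fin d} (hij : i ≠ j) {x y : HorocyclicVertex h} (hs : Shift p i j x y) :
    (horocyclicProduct G h).Adj x y :=
  ⟨i, j, hij, (hG _ _ _).2 (Or.inl hs.1), (hG _ _ _).2 (Or.inr hs.2.1), hs.2.2⟩

include hG hp in
theorem exists_shift_of_adj {x y : HorocyclicVertex h} (hxy : (horocyclicProduct G h).Adj x y) :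
    ∃ i j, i ≠ j ∧ Shift p i j x y := by
  obtain ⟨i, j, hij, hi, hj, hk⟩ := hxy
  have hsum : h i (x.1 i) - h i (y.1 i) + (h j (x.1 j) - h j (y.1 j)) = 0 := by
    rw [← Finset.sum_pair (f := fun k => h k (x.1 k) - h k (y.1 k)) hij,
      Finset.sum_subset (Finset.subset_univ _), Finset.sum_sub_distrib, x.2, y.2, sub_zero]
    intro k _ hk'
    simp only [Finset.mem_insert, Finset.mem_singleton, not_or] at hk'
    rw [hk k hk'.1 hk'.2, sub_self]
  -- Two predecessor moves or two successor moves would change the total height by two.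
  rcases (hG _ _ _).1 hi with hi | hi <;> rcases (hG _ _ _).1 hj with hj | hj
  · have h1 := hp i (x.1 i)
    have h2 := hp j (x.1 j)
    rw [hi] at h1
    rw [hj] at h2
    omega
  · exact ⟨i, j, hij, hi, hj, hk⟩
  · exact ⟨j, i, hij.symm, hj, hi, fun k h1 h2 => hk k h2 h1⟩
  · have h1 := hp i (y.1 i)
    have h2 := hp j (y.1 j)
    rw [hi] at h1
    rw [hj] at h2
    omega

/-- The vertices all whose coordinates `x j` descend from a given `a j`, by numbers of generations
which form a prescribed set. -/
theorem exists_finset_iterate_mem {q M : ℕ} (hp : ∀ j x, h j (p j x) = h j x - 1)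
    (hfin : ∀ j x, {y | p j y = x}.Finite) (hq : ∀ j x, {y | p j y = x}.ncard = q)
    (a : ∀ j, X j) (ha : ∑ j, h j (a j) = -M) (K : Finset (Fin d → ℕ))
    (hK : ∀ k ∈ K, ∑ j, k j = M) :
    ∃ F : Finset (HorocyclicVertex h),
      (∀ x, x ∈ F ↔ ∃ k ∈ K, ∀ j, (p j)^[k j] (x.1 j) = a j) ∧ F.card = K.card * q ^ M := by
  classical
  choose D hD hDc using fun j n => exists_finset_iterate_eq (p j) q (hfin j) (hq j) n (a j)
  have hiter : ∀ j n x, h j ((p j)^[n] x) = h j x - n := by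
    intro j n x
    induction n with
    | zero => simp
    | succ n ih =>
      rw [Function.iterate_succ_apply', hp, ih]
      push_cast
      ring
  let S : Finset (∀ j, X j) := K.biUnion fun k => Fintype.piFinset fun j => D j (k j)
  have hS : ∀ x, x ∈ S ↔ ∃ k ∈ K, ∀ j, (p j)^[k j] (x j) = a j := by
    simp [S, hD]
  have hSsum : ∀ x ∈ S, ∑ j, h j (x j) = 0 := by
    intro x hx
    obtain ⟨k, hk, hkx⟩ := (hS x).1 hx
    have h1 : ∀ j, h j (x j) = h j (a j) + k j := fun j => by
      rw [← hkx j, hiter]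
      ring
    have h2 : (∑ j, (k j : ℤ)) = M := by exact_mod_cast hK k hk
    simp only [h1, Finset.sum_add_distrib, ha, h2, neg_add_cancel]
  refine ⟨S.subtype fun x : ∀ j, X j => ∑ j, h j (x j) = 0, fun x => ?_, ?_⟩
  · exact Finset.mem_subtype.trans (hS x.1)
  · refine (Finset.card_subtype _ S).trans ?_
    rw [Finset.filter_true_of_mem hSsum, Finset.card_biUnion]
    · refine Finset.sum_const_nat fun k hk => ?_
      -- A common `q` makes the product of the `q ^ k j` depend only on the sum `M`.
      simp only [Fintype.card_piFinset, hDc, Finset.prod_pow_eq_pow_sum, hK k hk]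
    · intro k _ k' _ hkk'
      rw [Function.onFun, Finset.disjoint_left]
      intro x hx hx'
      simp only [Fintype.mem_piFinset, hD] at hx hx'
      -- Each `k j` is a height difference between `x j` and `a j`, so a vertex determines its
      -- composition.
      refine hkk' (funext fun j => ?_)
      have h1 := hiter j (k j) (x j)
      have h2 := hiter j (k' j) (x j)
      rw [hx] at h1
      rw [hx'] at h2
      omega

end HorocyclicVertex

end Horocyclic

/-! ### The two directions of the equivalence -/

namespace HorocyclicVertex

variable {d : ℕ} {X : Fin d → Type u} {G : ∀ j, SimpleGraph (X j)} {h : ∀ j, X j → ℤ}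
  {p : ∀ j, X j → X j} [∀ j, (G j).LocallyFinite]

theorem degree_pos (hd : 2 ≤ d) (hG : ∀ j x y, (G j).Adj x y ↔ p j x = y ∨ p j y = x)
    (hp : ∀ j x, h j (p j x) = h j x - 1) {q : Fin d → ℕ} (hq0 : ∀ j, 0 < q j)
    (hq : ∀ j x, {y | p j y = x}.ncard = q j) (x : HorocyclicVertex h) :
    0 < (horocyclicProduct G h).degree x := by
  have hij : (⟨0, by omega⟩ : Fin d) ≠ ⟨1, by omega⟩ := by simp
  have h1 := ncard_shift hp hij x
  rw [hq] at h1
  obtain ⟨y, hy⟩ := Set.nonempty_of_ncard_ne_zero (h1.trans_ne (hq0 _).ne')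
  exact (SimpleGraph.degree_pos_iff_exists_adj _ _).2 ⟨y, Shift.adj hG hij hy⟩

theorem not_isAmenable (hd : 2 ≤ d) [Nonempty (HorocyclicVertex h)]
    (hG : ∀ j x y, (G j).Adj x y ↔ p j x = y ∨ p j y = x)
    (hp : ∀ j x, h j (p j x) = h j x - 1) {D : Fin d → ℕ} (hD : ∀ j x, (G j).degree x ≤ D j)
    {q : Fin d → ℕ} (hq0 : ∀ j, 0 < q j) (hq : ∀ j x, {y | p j y = x}.ncard = q j)
    {i j : Fin d} (hij : q i < q j) : ¬ (horocyclicProduct G h).IsAmenable := by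
  have hne : i ≠ j := by
    rintro rfl
    exact hij.false
  refine SimpleGraph.not_isAmenable_of_card_le _ (horocyclicProduct_degree_le hD)
    (degree_pos hd hG hp hq0 hq) fun F => ?_
  have hflow := (horocyclicProduct G h).card_mul_le_ncard_edgeBoundarySet (Shift p i j)
    (fun x y => Shift.adj hG hne) (a := q i) (b := q j)
    (fun x => ((ncard_shift hp hne x).trans (hq _ _)).ge)
    (fun y => by
      simp only [shift_comm (i := i)]
      exact ((ncard_shift hp hne.symm y).trans (hq _ _)).le) F
  have := Nat.mul_le_mul_left F.card hij
  rw [Nat.succ_eq_add_one, mul_add, mul_one] at this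
  omega

theorem isAmenable (hd : 2 ≤ d) (hG : ∀ j x y, (G j).Adj x y ↔ p j x = y ∨ p j y = x)
    (hp : ∀ j x, h j (p j x) = h j x - 1) {D : Fin d → ℕ} (hD : ∀ j x, (G j).degree x ≤ D j)
    {q : ℕ} (hq0 : 0 < q) (hfin : ∀ j x, {y | p j y = x}.Finite)
    (hq : ∀ j x, {y | p j y = x}.ncard = q) (o : ∀ j, X j) (ho : ∀ j, h j (o j) = 0) :
    (horocyclicProduct G h).IsAmenable := by
  classical
  refine SimpleGraph.isAmenable_of_forall_exists _ (C := d * d * ∏ j, (D j + 1))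
    (degree_pos hd hG hp (q := fun _ => q) (fun _ => hq0) hq) fun n => ?_
  have hiter : ∀ j m, h j ((p j)^[m] (o j)) = -m := by
    intro j m
    induction m with
    | zero => simp [ho]
    | succ m ih =>
      rw [Function.iterate_succ_apply', hp, ih]
      push_cast
      ring
  set K : Finset (Fin d → ℕ) := Finset.piAntidiag Finset.univ (d * (n + 1)) with hKdef
  have hK : ∀ k, k ∈ K ↔ ∑ j, k j = d * (n + 1) := by simp [hKdef]
  have ha : ∑ j, h j ((p j)^[n + 1] (o j)) = -((d * (n + 1) : ℕ) : ℤ) := by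
    simp only [hiter, Finset.sum_const, Finset.card_univ, Fintype.card_fin, nsmul_eq_mul]
    push_cast
    ring
  obtain ⟨F, hF, hFc⟩ := exists_finset_iterate_mem hp hfin hq _ ha K fun k hk => (hK k).1 hk
  -- `B` consists of the vertices of `F` having some coordinate at the top `a i`, where a
  -- predecessor move would leave `F`.
  obtain ⟨B, hB, hBc⟩ := exists_finset_iterate_mem hp hfin hq _ ha (K.filter fun k => ∃ i, k i = 0)
    fun k hk => (hK k).1 (Finset.mem_filter.1 hk).1
  refine ⟨F, ?_, ?_⟩
  · rw [← Finset.card_pos, hFc]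
    have : 0 < K.card := Finset.card_pos.2 ⟨fun _ => n + 1, (hK _).2 (by simp)⟩
    positivity
  have hbd : ((horocyclicProduct G h).edgeBoundarySet F).ncard ≤ B.card * ∏ j, (D j + 1) := by
    refine SimpleGraph.ncard_edgeBoundarySet_le _ ?_ (horocyclicProduct_degree_le hD)
    intro x hx hxB y hxy
    obtain ⟨k, hk, hkx⟩ := (hF x).1 hx
    obtain ⟨i, j, hij, h1, h2, h3⟩ := exists_shift_of_adj hG hp hxy
    have hki : k i ≠ 0 := fun h0 =>
      hxB ((hB x).2 ⟨k, Finset.mem_filter.2 ⟨hk, i, h0⟩, hkx⟩)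
    -- The move takes one generation off coordinate `i` and adds one at `j`, preserving the sum.
    refine (hF y).2 ⟨Function.update (Function.update k i (k i - 1)) j (k j + 1), ?_, fun l => ?_⟩
    · rw [hK] at hk ⊢
      have key : Function.update (Function.update k i (k i - 1)) j (k j + 1) + Pi.single i 1
          = k + Pi.single j 1 := by
        ext l
        by_cases hj : l = j
        · subst hj
          simp [hij.symm]
        by_cases hi : l = i
        · subst hi
          simp [hj]
          omega
        · simp [hi, hj]
      have := congrArg (fun f : Fin d → ℕ => ∑ l, f l) key
      simpa [Finset.sum_add_distrib, hk] using this
    · by_cases hj : l = j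
      · subst hj
        rw [Function.update_self, Function.iterate_succ_apply, h2, hkx]
      by_cases hi : l = i
      · subst hi
        rw [Function.update_of_ne hj, Function.update_self, ← h1, ← Function.iterate_succ_apply,
          Nat.succ_eq_add_one, Nat.sub_add_cancel (Nat.pos_of_ne_zero hki), hkx]
      · rw [Function.update_of_ne hj, Function.update_of_ne hi, ← h3 l hi hj, hkx]
  -- With `n + 1` generations, chosen to be positive, the count gains a factor `n + 2`, of which
  -- only `n + 1` is needed.
  have hcount := card_piAntidiag_filter_exists_mul_le (d := d) n.succ_pos
  calc _ ≤ B.card * (∏ j, (D j + 1)) * (n + 1 + 1) :=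
        Nat.mul_le_mul hbd (Nat.le_succ _)
    _ = (K.filter fun k => ∃ i, k i = 0).card * (n + 1 + 1) *
          (q ^ (d * (n + 1)) * ∏ j, (D j + 1)) := by
        rw [hBc]
        ring
    _ ≤ d * d * K.card * (q ^ (d * (n + 1)) * ∏ j, (D j + 1)) :=
        Nat.mul_le_mul_right _ hcount
    _ = _ := by
        rw [hFc]
        ring

end HorocyclicVertex

theorem corollary2p6 {d : ℕ} (hd : 2 ≤ d) (q : Fin d → ℕ) (hq : ∀ j, 2 ≤ q j)
    {V : Fin d → Type u} (T : ∀ j, SimpleGraph (V j)) [∀ j, (T j).LocallyFinite]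
    (hT : ∀ j, (T j).IsTree) (hreg : ∀ j, (T j).IsRegularOfDegree (q j + 1))
    (ω : ∀ j, HoroOrientation (T j)) (o : ∀ j, V j) :
    (DLGraph T hT ω o).IsAmenable ↔ ∀ i j, q i = q j := by

  have hG : ∀ j x y, (T j).Adj x y ↔ (ω j).pred x = y ∨ (ω j).pred y = x :=
    fun j => (ω j).adj_iff
  have hp := fun j => (ω j).busemann_pred (hT j) (o j)
  have ho := fun j => (ω j).busemann_self (hT j) (o j)
  have hD : ∀ j x, (T j).degree x ≤ q j + 1 := fun j x => (hreg j x).le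
  have hs : ∀ j x, {y | (ω j).pred y = x}.ncard = q j := fun j => (ω j).ncard_successors (hreg j)
  have hq0 : ∀ j, 0 < q j := fun j => two_pos.trans_le (hq j)
  constructor
  · intro h i j
    have : Nonempty (HorocyclicVertex fun j => (ω j).busemann (hT j).connected (o j)) :=
      ⟨⟨o, Finset.sum_eq_zero fun j _ => ho j⟩⟩
    by_contra hij
    rcases lt_or_gt_of_ne hij with hlt | hlt
    · exact HorocyclicVertex.not_isAmenable hd hG hp hD hq0 hs hlt h
    · exact HorocyclicVertex.not_isAmenable hd hG hp hD hq0 hs hlt h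
  · intro h
    let i : Fin d := ⟨0, by omega⟩
    exact HorocyclicVertex.isAmenable hd hG hp hD (hq0 i) (fun j => (ω j).finite_successors)
      (fun j x => (hs j x).trans (h j i)) o ho
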